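/- Let $X_1,X_2,\dots$ be independent, identically distributed real random variables whose common distribution is absolutely continuous with probability density $f$, and suppose that $\int_{\mathbb R} f(x)^3\,dx<\infty$, so that the varextropy $$VJ(X)=\operatorname{Var}\!\left(-\tfrac12 f(X_1)\right)=\frac14\int_{\mathbb R} f^3(x)\,dx-\frac14\left[\int_{\mathbb R} f^2(x)\,dx\right]^2$$ is a well-defined finite number. For each $n$ let $X_{1:n}\le\dots\le X_{n:n}$ be the order statistics of $X_1,\dots,X_n$, with the conventions $X_{j:n}=X_{1:n}$ for $j<1$ and $X_{j:n}=X_{n:n}$ for $j>n$, and for a window size $m$, a positive integer less than $n/2$, put $$\widehat{\Delta}_1=\frac{1}{4n}\sum_{i=1}^{n}\left(\frac{2m/n}{X_{i+m:n}-X_{i-m:n}}\right)^{2}-\frac14\left[\frac1n\sum_{i=1}^{n}\frac{2m/n}{X_{i+m:n}-X_{i-m:n}}\right]^2 .$$ If the window size $m=m(n)$ satisfies $m\to\infty$ and $m/n\to0$ as $n\to\infty$, then $\widehat{\Delta}_1$ converges in probability to $VJ(X)$ as $n\to\infty$. -/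

import Mathlib

open MeasureTheory ProbabilityTheory Filter Topology

noncomputable section

/-- The varextropy `VJ(Y) = Var(-f(Y)/2)` of a random variable `Y` with density `f`,
with respect to the probability measure `P`. -/
def varextropy {Ω : Type*} [MeasurableSpace Ω] (P : Measure Ω) (f : ℝ → ℝ) (Y : Ω → ℝ) : ℝ :=
  variance (fun ω => -(1 / 2 : ℝ) * f (Y ω)) P

/-- The order statistics of a sample `x` of size `n`, listed in nondecreasing order. Indices are
`0`-based: `orderStatistic x i` is the `(i+1)`-st smallest observation. -/
def orderStatistic {n : ℕ} (x : Fin n → ℝ) (i : Fin n) : ℝ :=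
  x (Tuple.sort x i)

/-- The index `i + m`, replaced by the largest index if it exceeds it. -/
def upperIndex {n : ℕ} (m : ℕ) (i : Fin n) : Fin n :=
  ⟨min (i.val + m) (n - 1), by have := i.isLt; omega⟩

/-- The index `i - m`, replaced by the smallest index if it falls below it
(truncated subtraction, with `0` the smallest index). -/
def lowerIndex {n : ℕ} (m : ℕ) (i : Fin n) : Fin n :=
  ⟨i.val - m, by have := i.isLt; omega⟩

/-- The spacing-based density estimate `(2m/n) / (X_{i+m:n} - X_{i-m:n})` at the `i`-th order
statistic. -/
def spacingDensity {n : ℕ} (m : ℕ) (x : Fin n → ℝ) (i : Fin n) : ℝ :=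
  (2 * (m : ℝ) / (n : ℝ)) /
    (orderStatistic x (upperIndex m i) - orderStatistic x (lowerIndex m i))

/-- The spacing estimator of varextropy with window `m`, evaluated at the sample `x` of size
`n`. -/
def varextropyEstimator {n : ℕ} (m : ℕ) (x : Fin n → ℝ) : ℝ :=
  1 / (4 * (n : ℝ)) * ∑ i : Fin n, spacingDensity m x i ^ 2
    - 1 / 4 * (1 / (n : ℝ) * ∑ i : Fin n, spacingDensity m x i) ^ 2

end

open Classical in
/-- The number of entries of the sample `z` that lie in the set `s`. -/
noncomputable def sampleCount {N : ℕ} (z : Fin N → ℝ) (s : Set ℝ) : ℕ :=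
  (Finset.univ.filter fun j => z j ∈ s).card

open Classical in
theorem sampleCount_removeNth {N : ℕ} (x : Fin (N + 1) → ℝ) (k : Fin (N + 1)) (s : Set ℝ) :
    sampleCount (k.removeNth x) s =
      (Finset.univ.filter fun j => j ≠ k ∧ x j ∈ s).card := by
  unfold sampleCount
  refine Finset.card_bij (fun j _ => k.succAbove j) ?_ ?_ ?_
  · intro j hj
    simp only [Finset.mem_filter, Finset.mem_univ, true_and] at hj ⊢
    exact ⟨Fin.succAbove_ne k j, hj⟩
  · intro a _ b _ h
    exact Fin.succAbove_right_injective h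
  · intro j hj
    simp only [Finset.mem_filter, Finset.mem_univ, true_and] at hj
    obtain ⟨a, rfl⟩ := Fin.exists_succAbove_eq hj.1
    exact ⟨a, by simp only [Finset.mem_filter, Finset.mem_univ, true_and]; exact hj.2, rfl⟩

theorem sampleCount_mono {N : ℕ} (z : Fin N → ℝ) {s t : Set ℝ} (h : s ⊆ t) :
    sampleCount z s ≤ sampleCount z t := by
  classical
  unfold sampleCount
  refine Finset.card_le_card fun j hj => ?_
  simp only [Finset.mem_filter, Finset.mem_univ, true_and] at hj ⊢
  exact h hj

/-- The position of the observation `x k` in the sorted sample. -/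
noncomputable def sampleRank {n : ℕ} (x : Fin n → ℝ) (k : Fin n) : Fin n := (Tuple.sort x).symm k

theorem orderStatistic_monotone {n : ℕ} (x : Fin n → ℝ) : Monotone (orderStatistic x) :=
  Tuple.monotone_sort x

theorem orderStatistic_sampleRank {n : ℕ} (x : Fin n → ℝ) (k : Fin n) :
    orderStatistic x (sampleRank x k) = x k := by
  simp [orderStatistic, sampleRank]

theorem sampleRank_lt_of_lt {n : ℕ} (x : Fin n → ℝ) {j k : Fin n} (h : x j < x k) :
    sampleRank x j < sampleRank x k := by
  by_contra! hc
  have := orderStatistic_monotone x hc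
  rw [orderStatistic_sampleRank, orderStatistic_sampleRank] at this
  linarith

theorem card_le_of_sampleRank_mem {n : ℕ} (x : Fin n → ℝ) (A B : Finset (Fin n))
    (h : ∀ j ∈ A, sampleRank x j ∈ B) : A.card ≤ B.card :=
  Finset.card_le_card_of_injOn (sampleRank x) h (fun _ _ _ _ h => (Tuple.sort x).symm.injective h)

theorem card_le_of_sort_mem {n : ℕ} (x : Fin n → ℝ) (A B : Finset (Fin n))
    (h : ∀ i ∈ A, Tuple.sort x i ∈ B) : A.card ≤ B.card :=
  Finset.card_le_card_of_injOn (Tuple.sort x) h (fun _ _ _ _ h => (Tuple.sort x).injective h)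

theorem upper_le_of_le_sampleCount {N m : ℕ} (hm : 0 < m) (x : Fin (N + 1) → ℝ) (k : Fin (N + 1))
    {c : ℝ} (h : m ≤ sampleCount (k.removeNth x) (Set.Ioc (x k) c)) :
    (sampleRank x k).val + m ≤ N ∧
      orderStatistic x (upperIndex m (sampleRank x k)) ≤ c := by
  classical
  rw [sampleCount_removeNth] at h
  constructor
  · have h1 := h.trans (card_le_of_sampleRank_mem x _ (Finset.Ioi (sampleRank x k)) (by
      intro j hj
      simp only [Finset.mem_filter, Finset.mem_univ, true_and, Set.mem_Ioc, Finset.mem_Ioi] at hj ⊢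
      exact sampleRank_lt_of_lt x hj.2.1))
    rw [Fin.card_Ioi] at h1
    omega
  · by_contra! hc
    have h1 := h.trans (card_le_of_sampleRank_mem x _
      (Finset.Ioo (sampleRank x k) (upperIndex m (sampleRank x k))) (by
        intro j hj
        simp only [Finset.mem_filter, Finset.mem_univ, true_and, Set.mem_Ioc,
          Finset.mem_Ioo] at hj ⊢
        refine ⟨sampleRank_lt_of_lt x hj.2.1, ?_⟩
        by_contra! hle
        have := orderStatistic_monotone x hle
        rw [orderStatistic_sampleRank] at this
        linarith [hj.2.2]))
    rw [Fin.card_Ioo] at h1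
    simp only [upperIndex] at h1
    omega

theorem le_sampleCount_of_upper_le {N m : ℕ} (x : Fin (N + 1) → ℝ) (k : Fin (N + 1))
    {c : ℝ} (hi : (sampleRank x k).val + m ≤ N)
    (h : orderStatistic x (upperIndex m (sampleRank x k)) ≤ c) :
    m ≤ sampleCount (k.removeNth x) (Set.Icc (x k) c) := by
  classical
  rw [sampleCount_removeNth]
  refine le_trans ?_ (card_le_of_sort_mem x
    (Finset.Ioc (sampleRank x k) (upperIndex m (sampleRank x k))) _ ?_)
  · rw [Fin.card_Ioc]
    simp only [upperIndex]
    omega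
  · intro i hi
    simp only [Finset.mem_filter, Finset.mem_univ, true_and, Set.mem_Icc, Finset.mem_Ioc] at hi ⊢
    refine ⟨?_, ?_, (orderStatistic_monotone x hi.2).trans h⟩
    · rintro rfl
      simp [sampleRank] at hi
    · have := orderStatistic_monotone x hi.1.le
      rwa [orderStatistic_sampleRank] at this

theorem le_lower_of_le_sampleCount {N m : ℕ} (hm : 0 < m) (x : Fin (N + 1) → ℝ) (k : Fin (N + 1))
    {c : ℝ} (h : m ≤ sampleCount (k.removeNth x) (Set.Ico c (x k))) :
    m ≤ (sampleRank x k).val ∧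
      c ≤ orderStatistic x (lowerIndex m (sampleRank x k)) := by
  classical
  rw [sampleCount_removeNth] at h
  constructor
  · have h1 := h.trans (card_le_of_sampleRank_mem x _ (Finset.Iio (sampleRank x k)) (by
      intro j hj
      simp only [Finset.mem_filter, Finset.mem_univ, true_and, Set.mem_Ico, Finset.mem_Iio] at hj ⊢
      exact sampleRank_lt_of_lt x hj.2.2))
    rw [Fin.card_Iio] at h1
    omega
  · by_contra! hc
    have h1 := h.trans (card_le_of_sampleRank_mem x _
      (Finset.Ioo (lowerIndex m (sampleRank x k)) (sampleRank x k)) (by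
        intro j hj
        simp only [Finset.mem_filter, Finset.mem_univ, true_and, Set.mem_Ico,
          Finset.mem_Ioo] at hj ⊢
        refine ⟨?_, sampleRank_lt_of_lt x hj.2.2⟩
        by_contra! hle
        have := orderStatistic_monotone x hle
        rw [orderStatistic_sampleRank] at this
        linarith [hj.2.1]))
    rw [Fin.card_Ioo] at h1
    simp only [lowerIndex] at h1
    omega

theorem le_sampleCount_of_le_lower {N m : ℕ} (x : Fin (N + 1) → ℝ) (k : Fin (N + 1))
    {c : ℝ} (hi : m ≤ (sampleRank x k).val)
    (h : c ≤ orderStatistic x (lowerIndex m (sampleRank x k))) :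
    m ≤ sampleCount (k.removeNth x) (Set.Icc c (x k)) := by
  classical
  rw [sampleCount_removeNth]
  refine le_trans ?_ (card_le_of_sort_mem x
    (Finset.Ico (lowerIndex m (sampleRank x k)) (sampleRank x k)) _ ?_)
  · rw [Fin.card_Ico]
    simp only [lowerIndex]
    omega
  · intro i hi
    simp only [Finset.mem_filter, Finset.mem_univ, true_and, Set.mem_Icc, Finset.mem_Ico] at hi ⊢
    refine ⟨?_, h.trans (orderStatistic_monotone x hi.1), ?_⟩
    · rintro rfl
      simp [sampleRank] at hi
    · have := orderStatistic_monotone x hi.2.le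
      rwa [orderStatistic_sampleRank] at this

theorem sum_spacingDensity_eq {n : ℕ} (m : ℕ) (x : Fin n → ℝ) (p : ℕ) :
    ∑ i, spacingDensity m x i ^ p = ∑ k, spacingDensity m x (sampleRank x k) ^ p :=
  (Equiv.sum_comp (Tuple.sort x).symm fun i => spacingDensity m x i ^ p).symm

theorem lowerIndex_le {n : ℕ} (m : ℕ) (i : Fin n) : lowerIndex m i ≤ i := by
  simp [lowerIndex, Fin.le_def]

theorem le_upperIndex {n : ℕ} (m : ℕ) (i : Fin n) : i ≤ upperIndex m i := by
  simp only [upperIndex, Fin.le_def]; omega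

theorem spacingDensity_nonneg {n : ℕ} (m : ℕ) (x : Fin n → ℝ) (i : Fin n) :
    0 ≤ spacingDensity m x i := by
  refine div_nonneg (by positivity) (sub_nonneg.2 (orderStatistic_monotone x ?_))
  exact (lowerIndex_le m i).trans (le_upperIndex m i)

/-- A large spacing density forces many observations close to the central one. -/
theorem le_sampleCount_of_lt_spacingDensity {N m : ℕ} (hmN : 2 * m ≤ N) (x : Fin (N + 1) → ℝ)
    (k : Fin (N + 1)) {t : ℝ} (ht : 0 < t) (h : t < spacingDensity m x (sampleRank x k)) :
    m ≤ sampleCount (k.removeNth x)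
      (Set.Icc (x k - 2 * m / ((N + 1 : ℕ) * t)) (x k + 2 * m / ((N + 1 : ℕ) * t))) := by
  set i := sampleRank x k with hi
  have hl := orderStatistic_monotone x (lowerIndex_le m i)
  have hu := orderStatistic_monotone x (le_upperIndex m i)
  rw [hi, orderStatistic_sampleRank, ← hi] at hl hu
  have hd : 0 < orderStatistic x (upperIndex m i) - orderStatistic x (lowerIndex m i) := by
    rcases (sub_nonneg.2 (hl.trans hu)).lt_or_eq with h0 | h0
    · exact h0
    · rw [spacingDensity, ← h0, div_zero] at h
      exact absurd h ht.not_gt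
  have hr : orderStatistic x (upperIndex m i) - orderStatistic x (lowerIndex m i)
      < 2 * m / ((N + 1 : ℕ) * t) := by
    rw [spacingDensity, lt_div_iff₀ hd, mul_comm, ← lt_div_iff₀ ht, div_div] at h
    exact h
  by_cases hc : i.val + m ≤ N
  · exact (le_sampleCount_of_upper_le x k hc (c := x k + 2 * m / ((N + 1 : ℕ) * t))
      (by rw [← hi]; linarith)).trans (sampleCount_mono _ (Set.Icc_subset_Icc (by linarith) le_rfl))
  · exact (le_sampleCount_of_le_lower x k (m := m) (by rw [← hi]; omega)
      (c := x k - 2 * m / ((N + 1 : ℕ) * t))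
      (by rw [← hi]; linarith)).trans (sampleCount_mono _ (Set.Icc_subset_Icc le_rfl (by linarith)))

/-- The counting events that force the spacing density at an observation `y` with neighbours `z`
to be close to the value `2 * m / n / (2 * ρ)`. -/
def spacingTrap {N : ℕ} (m : ℕ) (y ρ₁ ρ₂ : ℝ) (z : Fin N → ℝ) : Prop :=
  (m ≤ sampleCount z (Set.Ioc y (y + ρ₂)) ∧ m ≤ sampleCount z (Set.Ico (y - ρ₂) y)) ∧
    sampleCount z (Set.Icc y (y + ρ₁)) < m ∧ sampleCount z (Set.Icc (y - ρ₁) y) < m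

theorem spacingDensity_mem_of_spacingTrap {N m : ℕ} (hm : 0 < m) (x : Fin (N + 1) → ℝ)
    (k : Fin (N + 1)) {ρ₁ ρ₂ : ℝ} (h₁ : 0 < ρ₁) (h : spacingTrap m (x k) ρ₁ ρ₂ (k.removeNth x)) :
    spacingDensity m x (sampleRank x k) ∈
      Set.Icc (m / ((N + 1 : ℕ) * ρ₂)) (m / ((N + 1 : ℕ) * ρ₁)) := by
  obtain ⟨⟨hu, hl⟩, hu', hl'⟩ := h
  obtain ⟨hu1, hu2⟩ := upper_le_of_le_sampleCount hm x k hu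
  obtain ⟨hl1, hl2⟩ := le_lower_of_le_sampleCount hm x k hl
  have hu3 : x k + ρ₁ < orderStatistic x (upperIndex m (sampleRank x k)) := by
    by_contra! hc
    exact hu'.not_ge (le_sampleCount_of_upper_le x k hu1 hc)
  have hl3 : orderStatistic x (lowerIndex m (sampleRank x k)) < x k - ρ₁ := by
    by_contra! hc
    exact hl'.not_ge (le_sampleCount_of_le_lower x k hl1 hc)
  have hρ : ρ₁ < ρ₂ := by linarith
  have key : ∀ ρ : ℝ, (m : ℝ) / ((N + 1 : ℕ) * ρ) = 2 * m / (N + 1 : ℕ) / (2 * ρ) := by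
    intro ρ
    rw [div_div, mul_left_comm, mul_div_mul_left _ _ two_ne_zero]
  rw [key, key, spacingDensity]
  constructor
  · exact div_le_div_of_nonneg_left (by positivity) (by linarith) (by linarith)
  · exact div_le_div_of_nonneg_left (by positivity) (by linarith) (by linarith)

theorem pow_sampleCount_eq_prod {N : ℕ} (z : Fin N → ℝ) (s : Set ℝ) (a : ℝ) :
    a ^ sampleCount z s = ∏ j, (s.indicator (fun _ => a - 1) (z j) + 1) := by
  classical
  unfold sampleCount
  rw [← Finset.prod_const, Finset.prod_filter]
  refine Finset.prod_congr rfl fun j _ => ?_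
  by_cases h : z j ∈ s <;> simp [h]

theorem integral_pow_sampleCount (μ : Measure ℝ) [IsProbabilityMeasure μ] (N : ℕ) {s : Set ℝ}
    (hs : MeasurableSet s) (a : ℝ) :
    ∫ z : Fin N → ℝ, a ^ sampleCount z s ∂Measure.pi (fun _ => μ) =
      ((a - 1) * μ.real s + 1) ^ N := by
  simp only [pow_sampleCount_eq_prod]
  rw [integral_fintype_prod_eq_pow (fun y => s.indicator (fun _ => a - 1) y + 1)]
  rw [Fintype.card_fin, integral_add _ (integrable_const _), integral_indicator_const _ hs]
  · simp [mul_comm]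
  · exact (integrable_const _).indicator hs

theorem integrable_pow_sampleCount (μ : Measure ℝ) [IsProbabilityMeasure μ] (N : ℕ) {s : Set ℝ}
    (hs : MeasurableSet s) (a : ℝ) :
    Integrable (fun z : Fin N → ℝ => a ^ sampleCount z s) (Measure.pi (fun _ => μ)) := by
  simp only [pow_sampleCount_eq_prod]
  exact Integrable.fintype_prod (μ := fun _ : Fin N => μ)
    (f := fun _ y => s.indicator (fun _ => a - 1) y + 1)
    fun _ => ((integrable_const _).indicator hs).add (integrable_const _)

theorem measureReal_le_of_pow_le (μ : Measure ℝ) [IsProbabilityMeasure μ] {N m : ℕ} {s : Set ℝ}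
    (hs : MeasurableSet s) {θ : ℝ} (hθ : 0 < θ) {E : Set (Fin N → ℝ)}
    (hE : ∀ z ∈ E, θ⁻¹ ^ m ≤ θ⁻¹ ^ sampleCount z s)
    (h : (θ⁻¹ - 1) * (N * μ.real s) ≤ (θ⁻¹ - 1) * (θ * m)) :
    (Measure.pi fun _ : Fin N => μ).real E ≤ Real.exp (m * (Real.log θ + 1 - θ)) := by
  have h1 := mul_meas_ge_le_integral_of_nonneg (μ := Measure.pi fun _ : Fin N => μ)
    (Eventually.of_forall fun z => (by positivity : (0 : ℝ) ≤ θ⁻¹ ^ sampleCount z s))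
    (integrable_pow_sampleCount μ N hs θ⁻¹) (θ⁻¹ ^ m)
  have h2 : (Measure.pi fun _ : Fin N => μ).real E ≤
      (Measure.pi fun _ : Fin N => μ).real {z | θ⁻¹ ^ m ≤ θ⁻¹ ^ sampleCount z s} :=
    measureReal_mono fun z hz => hE z hz
  rw [integral_pow_sampleCount μ N hs] at h1
  have h0 : 0 ≤ (θ⁻¹ - 1) * μ.real s + 1 := by
    have : μ.real s ≤ 1 := measureReal_le_one
    have h3 : 0 ≤ μ.real s := measureReal_nonneg
    have : 0 < θ⁻¹ := by positivity
    nlinarith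
  have h3 : ((θ⁻¹ - 1) * μ.real s + 1) ^ N ≤ Real.exp (m * (1 - θ)) := by
    calc ((θ⁻¹ - 1) * μ.real s + 1) ^ N ≤ Real.exp ((θ⁻¹ - 1) * μ.real s) ^ N :=
          pow_le_pow_left₀ h0 (Real.add_one_le_exp _) _
      _ = Real.exp ((θ⁻¹ - 1) * (N * μ.real s)) := by rw [← Real.exp_nat_mul]; ring_nf
      _ ≤ Real.exp ((θ⁻¹ - 1) * (θ * m)) := Real.exp_le_exp.2 h
      _ = Real.exp (m * (1 - θ)) := by congr 1; field_simp
  have h4 : Real.exp (m * (Real.log θ + 1 - θ)) = θ ^ m * Real.exp (m * (1 - θ)) := by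
    rw [show (m : ℝ) * (Real.log θ + 1 - θ) = m * Real.log θ + m * (1 - θ) by ring, Real.exp_add,
      Real.exp_nat_mul, Real.exp_log hθ]
  rw [h4]
  have h5 : θ ^ m * θ⁻¹ ^ m = 1 := by rw [← mul_pow, mul_inv_cancel₀ hθ.ne', one_pow]
  calc _ ≤ _ := h2
    _ = θ ^ m * (θ⁻¹ ^ m * (Measure.pi fun _ : Fin N => μ).real
          {z | θ⁻¹ ^ m ≤ θ⁻¹ ^ sampleCount z s}) := by rw [← mul_assoc, h5, one_mul]
    _ ≤ _ := mul_le_mul_of_nonneg_left (h1.trans h3) (by positivity)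

theorem measureReal_le_sampleCount_le (μ : Measure ℝ) [IsProbabilityMeasure μ] {N m : ℕ}
    {s : Set ℝ} (hs : MeasurableSet s) {θ : ℝ} (hθ : 0 < θ) (hθ1 : θ ≤ 1)
    (h : N * μ.real s ≤ θ * m) :
    (Measure.pi fun _ : Fin N => μ).real {z | m ≤ sampleCount z s} ≤
      Real.exp (m * (Real.log θ + 1 - θ)) := by
  have h1 : 1 ≤ θ⁻¹ := (one_le_inv₀ hθ).2 hθ1
  exact measureReal_le_of_pow_le μ hs hθ (fun z hz => pow_le_pow_right₀ h1 hz)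
    (mul_le_mul_of_nonneg_left h (by linarith))

theorem measureReal_sampleCount_lt_le (μ : Measure ℝ) [IsProbabilityMeasure μ] {N m : ℕ}
    {s : Set ℝ} (hs : MeasurableSet s) {θ : ℝ} (hθ1 : 1 ≤ θ) (h : θ * m ≤ N * μ.real s) :
    (Measure.pi fun _ : Fin N => μ).real {z | sampleCount z s < m} ≤
      Real.exp (m * (Real.log θ + 1 - θ)) := by
  have hθ : 0 < θ := by linarith
  have h1 : θ⁻¹ ≤ 1 := inv_le_one_of_one_le₀ hθ1
  exact measureReal_le_of_pow_le μ hs hθ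
    (fun z hz => pow_le_pow_of_le_one (by positivity) h1 (le_of_lt hz))
    (mul_le_mul_of_nonpos_left h (by linarith))

/-- A polynomial tail bound for the number of observations in a set. -/
theorem measureReal_le_sampleCount_le_pow_four (μ : Measure ℝ) [IsProbabilityMeasure μ] {N m : ℕ}
    (hm : 4 ≤ m) {s : Set ℝ} (hs : MeasurableSet s) {y : ℝ} (hy : 0 ≤ y)
    (h : N * μ.real s ≤ y * m) :
    (Measure.pi fun _ : Fin N => μ).real {z | m ≤ sampleCount z s} ≤
      min 1 ((3 * y) ^ 4) := by
  refine le_min measureReal_le_one ?_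
  have hm0 : (0 : ℝ) < m := by exact_mod_cast (by omega : 0 < m)
  have key : ∀ θ : ℝ, y < θ → 3 * θ < 1 →
      (Measure.pi fun _ : Fin N => μ).real {z | m ≤ sampleCount z s} ≤ (3 * θ) ^ 4 := by
    intro θ hyθ hθ
    have hθ0 : 0 < θ := hy.trans_lt hyθ
    refine (measureReal_le_sampleCount_le μ hs hθ0 (by linarith) (h.trans ?_)).trans ?_
    · gcongr
    · have : Real.exp (m * (Real.log θ + 1 - θ)) ≤ Real.exp (m * (Real.log θ + 1)) := by
        apply Real.exp_le_exp.2; gcongr; linarith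
      refine this.trans ?_
      rw [Real.exp_nat_mul, Real.exp_add, Real.exp_log hθ0]
      have h3 : Real.exp 1 ≤ 3 := Real.exp_one_lt_three.le
      calc (θ * Real.exp 1) ^ m ≤ (3 * θ) ^ m := by
            rw [mul_comm]; gcongr
        _ ≤ (3 * θ) ^ 4 := pow_le_pow_of_le_one (by positivity) hθ.le hm
  by_cases h1 : 3 * y < 1
  · have hc : Tendsto (fun θ : ℝ => (3 * θ) ^ 4) (𝓝[>] y) (𝓝 ((3 * y) ^ 4)) :=
      ((by fun_prop : Continuous fun θ : ℝ => (3 * θ) ^ 4).tendsto y).mono_left nhdsWithin_le_nhds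
    refine ge_of_tendsto hc ?_
    have : ∀ᶠ θ in 𝓝[>] y, θ < 1 / 3 :=
      (eventually_lt_nhds (by linarith : y < 1 / 3)).filter_mono nhdsWithin_le_nhds
    filter_upwards [this, self_mem_nhdsWithin] with θ h2 h3
    exact key θ h3 (by linarith)
  · exact measureReal_le_one.trans (one_le_pow₀ (by linarith))

open scoped ENNReal in
theorem lintegral_pow_four_le {α : Type*} [MeasurableSpace α] (ν : Measure α) {h : α → ℝ≥0∞}
    (hh : Measurable h) : (∫⁻ y, h y ∂ν) ^ 4 ≤ ν Set.univ ^ 3 * ∫⁻ y, h y ^ 4 ∂ν := by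
  have hpq : (4 : ℝ).HolderConjugate (4 / 3) := by
    rw [Real.holderConjugate_iff]; norm_num
  have h1 := ENNReal.lintegral_mul_le_Lp_mul_Lq ν hpq hh.aemeasurable
    (g := fun _ => 1) aemeasurable_const
  simp only [Pi.mul_apply, mul_one, ENNReal.one_rpow, lintegral_const, one_mul] at h1
  have h2 := pow_le_pow_left₀ zero_le h1 4
  rw [mul_pow, ← ENNReal.rpow_natCast (_ ^ (1 / 4 : ℝ)) 4,
    ← ENNReal.rpow_natCast (_ ^ (1 / (4 / 3) : ℝ)) 4, ← ENNReal.rpow_mul, ← ENNReal.rpow_mul,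
    mul_comm] at h2
  norm_num at h2
  exact_mod_cast h2

open scoped ENNReal in
theorem setLIntegral_Icc_eq_indicator (h : ℝ → ℝ≥0∞) (r x : ℝ) :
    ∫⁻ y in Set.Icc (x - r) (x + r), h y =
      ∫⁻ y, {q : ℝ × ℝ | q.2 ∈ Set.Icc (q.1 - r) (q.1 + r)}.indicator (fun q => h q.2) (x, y) := by
  rw [← lintegral_indicator measurableSet_Icc]
  rfl

open scoped ENNReal in
theorem measurable_indicator_Icc {h : ℝ → ℝ≥0∞} (hh : Measurable h) (r : ℝ) :
    Measurable ({q : ℝ × ℝ | q.2 ∈ Set.Icc (q.1 - r) (q.1 + r)}.indicator fun q => h q.2) := by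
  refine (hh.comp measurable_snd).indicator (IsClosed.measurableSet ?_)
  simp only [Set.mem_Icc, Set.ofPred_and]
  exact (isClosed_le (by fun_prop) (by fun_prop)).inter (isClosed_le (by fun_prop) (by fun_prop))

open scoped ENNReal in
theorem measurable_setLIntegral_Icc {h : ℝ → ℝ≥0∞} (hh : Measurable h) (r : ℝ) :
    Measurable fun x => ∫⁻ y in Set.Icc (x - r) (x + r), h y := by
  simp_rw [setLIntegral_Icc_eq_indicator]
  exact (measurable_indicator_Icc hh r).lintegral_prod_right'

open scoped ENNReal in
theorem lintegral_lintegral_Icc {h : ℝ → ℝ≥0∞} (hh : Measurable h) (r : ℝ) :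
    ∫⁻ x, ∫⁻ y in Set.Icc (x - r) (x + r), h y = ENNReal.ofReal (2 * r) * ∫⁻ y, h y := by
  simp_rw [setLIntegral_Icc_eq_indicator]
  rw [lintegral_lintegral_swap (f := fun x y => {q : ℝ × ℝ | q.2 ∈ Set.Icc (q.1 - r) (q.1 + r)}.indicator
    (fun q => h q.2) (x, y)) (measurable_indicator_Icc hh r).aemeasurable,
    ← lintegral_const_mul _ hh]
  refine lintegral_congr fun y => ?_
  have h2 : ∀ x, {q : ℝ × ℝ | q.2 ∈ Set.Icc (q.1 - r) (q.1 + r)}.indicator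
      (fun q => h q.2) (x, y) = (Set.Icc (y - r) (y + r)).indicator (fun _ => h y) x := by
    intro x
    simp only [Set.indicator, Set.mem_ofPred_eq, Set.mem_Icc]
    congr 1
    apply propext
    constructor <;> rintro ⟨_, _⟩ <;> constructor <;> linarith
  simp_rw [h2]
  rw [lintegral_indicator measurableSet_Icc, setLIntegral_const, Real.volume_Icc, mul_comm]
  congr 2
  ring

/-- The pointwise bound that controls the tail of the spacing densities at level `t`. -/
noncomputable def tailBound (t v : ℝ) : ℝ :=
  25 * (if t < v then v else 0) + 24 ^ 4 / t ^ 3 * (if v ≤ t then v ^ 4 else 0)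

theorem measurable_tailBound (t : ℝ) : Measurable (tailBound t) := by
  unfold tailBound
  refine Measurable.add (Measurable.const_mul ?_ _) (Measurable.const_mul ?_ _)
  · exact Measurable.ite measurableSet_Ioi measurable_id measurable_const
  · exact Measurable.ite measurableSet_Iic (measurable_id.pow_const 4) measurable_const

theorem tailBound_nonneg {t v : ℝ} (ht : 0 < t) (hv : 0 ≤ v) : 0 ≤ tailBound t v := by
  unfold tailBound
  have h1 : (0 : ℝ) ≤ if t < v then v else 0 := by split_ifs <;> simp [hv]
  have h2 : (0 : ℝ) ≤ if v ≤ t then v ^ 4 else 0 := by split_ifs <;> positivity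
  positivity

theorem sum_four_pow_le {v : ℝ} (hv : 0 ≤ v) (J : ℕ) :
    ∑ j ∈ Finset.range J, (if (2 : ℝ) ^ j < v then (4 : ℝ) ^ j else 0) ≤ min (2 ^ J) (2 * v) ^ 2 := by
  induction J with
  | zero => simp; positivity
  | succ J ih =>
    rw [Finset.sum_range_succ]
    have h0 : (0 : ℝ) < 2 ^ J := by positivity
    have h4 : (4 : ℝ) ^ J = (2 ^ J) ^ 2 := by rw [← pow_mul, mul_comm, pow_mul]; norm_num
    split_ifs with h
    · rw [min_eq_left (by linarith)] at ih
      rw [min_eq_left (by rw [pow_succ]; linarith), pow_succ (2 : ℝ) J, h4]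
      nlinarith
    · rw [add_zero]
      refine ih.trans (pow_le_pow_left₀ (by positivity) (min_le_min ?_ le_rfl) 2)
      rw [pow_succ]; linarith

theorem sum_inv_two_pow_le {v : ℝ} (hv : 0 < v) (J : ℕ) :
    ∑ j ∈ Finset.range J, (if v ≤ (2 : ℝ) ^ j then v / 2 ^ j else 0) ≤
      2 - 2 * v / max (2 ^ J) v := by
  induction J with
  | zero =>
    have : 0 < max (2 ^ 0) v := by simp
    rw [Finset.sum_range_zero, sub_nonneg, div_le_iff₀ this]
    have := le_max_right (2 ^ 0) v
    linarith
  | succ J ih =>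
    rw [Finset.sum_range_succ]
    have h0 : (0 : ℝ) < 2 ^ J := by positivity
    split_ifs with h
    · rw [max_eq_left h] at ih
      rw [max_eq_left (by rw [pow_succ]; linarith), pow_succ]
      have : 2 * v / (2 ^ J * 2) = v / 2 ^ J := by field_simp
      rw [this]
      have : 2 * v / 2 ^ J = 2 * (v / 2 ^ J) := by ring
      linarith
    · rw [add_zero]
      refine ih.trans (sub_le_sub_left ?_ 2)
      refine div_le_div_of_nonneg_left (by positivity) (by positivity) (max_le_max ?_ le_rfl)
      rw [pow_succ]; linarith

theorem sum_tailBound_le {v : ℝ} (hv : 0 ≤ v) (J : ℕ) :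
    ∑ j ∈ Finset.range J, 4 ^ (j + 1) * tailBound (2 ^ j) v ≤ (400 + 8 * 24 ^ 4) * v ^ 3 := by
  rcases hv.eq_or_lt with rfl | hv0
  · refine (Finset.sum_nonpos fun j _ => ?_).trans (by simp)
    simp [tailBound]
  have h1 := sum_four_pow_le hv J
  have h2 := sum_inv_two_pow_le hv0 J
  have h3 : ∀ j : ℕ, 4 ^ (j + 1) * tailBound (2 ^ j) v =
      100 * v * (if (2 : ℝ) ^ j < v then (4 : ℝ) ^ j else 0) +
        4 * 24 ^ 4 * v ^ 3 * (if v ≤ (2 : ℝ) ^ j then v / 2 ^ j else 0) := by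
    intro j
    have h4 : (4 : ℝ) ^ j = (2 ^ j) ^ 2 := by rw [← pow_mul, mul_comm, pow_mul]; norm_num
    have h0 : (0 : ℝ) < 2 ^ j := by positivity
    unfold tailBound
    rw [pow_succ, h4]
    split_ifs <;> field_simp <;> ring
  simp_rw [h3]
  rw [Finset.sum_add_distrib, ← Finset.mul_sum, ← Finset.mul_sum]
  have h4 : min (2 ^ J) (2 * v) ^ 2 ≤ (2 * v) ^ 2 :=
    pow_le_pow_left₀ (by positivity) (min_le_right _ _) 2
  have h5 : 0 ≤ 2 * v / max (2 ^ J) v := by positivity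
  have h6 := mul_le_mul_of_nonneg_left (h1.trans h4) (by positivity : 0 ≤ 100 * v)
  have h7 := mul_le_mul_of_nonneg_left (h2.trans (by linarith : _ ≤ (2 : ℝ)))
    (by positivity : 0 ≤ 4 * 24 ^ 4 * v ^ 3)
  nlinarith

open scoped ENNReal in
theorem min_one_add_pow_four_le (a b : ℝ≥0∞) : min 1 ((a + b) ^ 4) ≤ (2 * a) ^ 4 + 2 * b := by
  rcases le_total a b with h | h
  · refine le_trans ?_ le_add_self
    have hab : a + b ≤ 2 * b := by rw [two_mul]; gcongr
    by_cases h1 : 2 * b ≤ 1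
    · refine (min_le_right _ _).trans ((pow_le_pow_left₀ zero_le hab 4).trans ?_)
      calc (2 * b) ^ 4 ≤ (2 * b) ^ 1 := pow_le_pow_of_le_one zero_le h1 (by norm_num)
        _ = _ := pow_one _
    · exact (min_le_left _ _).trans (le_of_not_ge h1)
  · refine le_trans (min_le_right _ _) (le_trans ?_ le_self_add)
    refine pow_le_pow_left₀ zero_le ?_ 4
    rw [two_mul]; gcongr

open scoped ENNReal in
/-- An interpolation bound for averages of a density over intervals of one fixed length. -/
theorem lintegral_mul_min_le {f : ℝ → ℝ} (hf : Measurable f) (hf0 : ∀ x, 0 ≤ f x) {r t K : ℝ}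
    (hr : 0 < r) (ht : 0 < t) (hK : 0 ≤ K) (hrK : 2 * r * K = 12 / t) :
    ∫⁻ x, ENNReal.ofReal (f x) * min 1 ((ENNReal.ofReal K *
        ∫⁻ y in Set.Icc (x - r) (x + r), ENNReal.ofReal (f y)) ^ 4) ≤
      ∫⁻ x, ENNReal.ofReal (tailBound t (f x)) := by
  set lo : ℝ → ℝ≥0∞ := fun x => ENNReal.ofReal (if f x ≤ t then f x else 0) with hlo
  set hi : ℝ → ℝ≥0∞ := fun x => ENNReal.ofReal (if t < f x then f x else 0) with hhi
  have mlo : Measurable lo :=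
    (Measurable.ite (measurableSet_le hf measurable_const) hf measurable_const).ennreal_ofReal
  have mhi : Measurable hi :=
    (Measurable.ite (measurableSet_lt measurable_const hf) hf measurable_const).ennreal_ofReal
  have hsplit : ∀ x, ENNReal.ofReal (f x) = lo x + hi x := by
    intro x
    simp only [hlo, hhi]
    by_cases h : f x ≤ t
    · simp [h, h.not_gt]
    · simp [h, not_le.1 h]
  set k := ENNReal.ofReal K
  set A : ℝ → ℝ≥0∞ := fun x => ∫⁻ y in Set.Icc (x - r) (x + r), lo y
  set B : ℝ → ℝ≥0∞ := fun x => ∫⁻ y in Set.Icc (x - r) (x + r), hi y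
  have hvol : ∀ x : ℝ, volume.restrict (Set.Icc (x - r) (x + r)) Set.univ =
      ENNReal.ofReal (2 * r) := by
    intro x
    rw [Measure.restrict_apply_univ, Real.volume_Icc]
    congr 1; ring
  have hA : ∫⁻ x, A x ^ 4 ≤ ENNReal.ofReal (2 * r) ^ 4 * ∫⁻ x, lo x ^ 4 := by
    calc ∫⁻ x, A x ^ 4 ≤ ∫⁻ x, ENNReal.ofReal (2 * r) ^ 3 *
          ∫⁻ y in Set.Icc (x - r) (x + r), lo y ^ 4 := by
          refine lintegral_mono fun x => ?_
          have := lintegral_pow_four_le (volume.restrict (Set.Icc (x - r) (x + r))) mlo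
          rwa [hvol] at this
      _ = ENNReal.ofReal (2 * r) ^ 4 * ∫⁻ x, lo x ^ 4 := by
          rw [lintegral_const_mul' _ _ (by finiteness), lintegral_lintegral_Icc (mlo.pow_const 4),
            ← mul_assoc, ← pow_succ]
  have hB : ∫⁻ x, B x = ENNReal.ofReal (2 * r) * ∫⁻ x, hi x := lintegral_lintegral_Icc mhi r
  have hAB : ∀ x, k * ∫⁻ y in Set.Icc (x - r) (x + r), ENNReal.ofReal (f y) =
      k * A x + k * B x := by
    intro x
    simp_rw [hsplit]
    rw [lintegral_add_left mlo, mul_add]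
  have hpt : ∀ x, ENNReal.ofReal (f x) * min 1 ((k *
        ∫⁻ y in Set.Icc (x - r) (x + r), ENNReal.ofReal (f y)) ^ 4) ≤
      hi x + ENNReal.ofReal t * ((2 * k) ^ 4 * A x ^ 4 + 2 * k * B x) := by
    intro x
    rw [hsplit, add_mul, add_comm]
    gcongr
    · exact mul_le_of_le_one_right zero_le (min_le_left _ _)
    · simp only [hlo]
      split_ifs with h
      · exact ENNReal.ofReal_le_ofReal h
      · simp
    · rw [hAB]
      refine (min_one_add_pow_four_le _ _).trans (le_of_eq ?_)
      ring
  have hkr : ENNReal.ofReal t * (k * ENNReal.ofReal (2 * r)) = 12 := by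
    rw [← ENNReal.ofReal_mul hK, mul_comm K, hrK, ← ENNReal.ofReal_mul ht.le,
      mul_div_cancel₀ _ ht.ne']
    norm_num
  calc _ ≤ ∫⁻ x, (hi x + ENNReal.ofReal t * ((2 * k) ^ 4 * A x ^ 4 + 2 * k * B x)) :=
        lintegral_mono hpt
    _ ≤ (∫⁻ x, hi x) + ENNReal.ofReal t * ((2 * k) ^ 4 * (ENNReal.ofReal (2 * r) ^ 4 *
          ∫⁻ x, lo x ^ 4) + 2 * k * (ENNReal.ofReal (2 * r) * ∫⁻ x, hi x)) := by
        rw [lintegral_add_left mhi, lintegral_const_mul' _ _ (by finiteness),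
          lintegral_add_right _ ((measurable_setLIntegral_Icc mhi r).const_mul (2 * k)),
          lintegral_const_mul' _ _ (by finiteness), lintegral_const_mul' _ _ (by finiteness), hB]
        gcongr
    _ = 25 * (∫⁻ x, hi x) + ENNReal.ofReal (24 ^ 4 / t ^ 3) * ∫⁻ x, lo x ^ 4 := by
        have e1 : ENNReal.ofReal t * (2 * k) ^ 4 * ENNReal.ofReal (2 * r) ^ 4 =
            ENNReal.ofReal (24 ^ 4 / t ^ 3) := by
          rw [show (2 : ℝ≥0∞) = ENNReal.ofReal 2 by simp, ← ENNReal.ofReal_mul (by norm_num),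
            ← ENNReal.ofReal_pow (by positivity), ← ENNReal.ofReal_pow (by positivity),
            ← ENNReal.ofReal_mul (by positivity), ← ENNReal.ofReal_mul (by positivity)]
          congr 1
          rw [show t * (2 * K) ^ 4 * (2 * r) ^ 4 = t * (2 * (2 * r * K)) ^ 4 by ring, hrK]
          field_simp
          norm_num
        have e2 : ENNReal.ofReal t * (2 * k * (ENNReal.ofReal (2 * r) * ∫⁻ x, hi x)) =
            24 * ∫⁻ x, hi x := by
          rw [show ENNReal.ofReal t * (2 * k * (ENNReal.ofReal (2 * r) * ∫⁻ x, hi x)) =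
            2 * (ENNReal.ofReal t * (k * ENNReal.ofReal (2 * r))) * ∫⁻ x, hi x by ring, hkr]
          norm_num
        rw [mul_add, e2, ← mul_assoc, ← mul_assoc, e1]
        ring
    _ = ∫⁻ x, ENNReal.ofReal (tailBound t (f x)) := by
        rw [← lintegral_const_mul _ mhi, ← lintegral_const_mul _ (mlo.pow_const 4),
          ← lintegral_add_left (mhi.const_mul _)]
        refine lintegral_congr fun x => ?_
        have h1 : (0 : ℝ) ≤ if t < f x then f x else 0 := by split_ifs <;> simp [hf0]
        have h2 : (0 : ℝ) ≤ if f x ≤ t then f x else 0 := by split_ifs <;> simp [hf0]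
        have h3 : (if f x ≤ t then f x else 0) ^ 4 = if f x ≤ t then f x ^ 4 else 0 := by
          split_ifs <;> simp
        have h4 : (0 : ℝ) ≤ if f x ≤ t then f x ^ 4 else 0 := by rw [← h3]; positivity
        simp only [hlo, hhi, tailBound]
        rw [ENNReal.ofReal_add (by positivity) (by positivity), ENNReal.ofReal_mul (by norm_num),
          ENNReal.ofReal_mul (by positivity), ← ENNReal.ofReal_pow h2, h3]
        norm_num

theorem measurable_sampleCount_prod {N : ℕ} {S : ℝ → Set ℝ}
    (hS : MeasurableSet {q : ℝ × ℝ | q.2 ∈ S q.1}) :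
    Measurable fun q : ℝ × (Fin N → ℝ) => sampleCount q.2 (S q.1) := by
  classical
  unfold sampleCount
  simp only [Finset.card_filter]
  refine Finset.measurable_sum _ fun j _ => ?_
  refine Measurable.ite ?_ measurable_const measurable_const
  have : Measurable fun q : ℝ × (Fin N → ℝ) => (q.1, q.2 j) := by fun_prop
  exact this hS

theorem tendsto_measureReal_le_sampleCount (μ : Measure ℝ) [IsProbabilityMeasure μ]
    {s : ℕ → Set ℝ} (hs : ∀ N, MeasurableSet (s N)) {m : ℕ → ℕ} (hm : Tendsto m atTop atTop)
    {l : ℝ} (hl0 : 0 ≤ l) (hl : l < 1)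
    (h : Tendsto (fun N : ℕ => N * μ.real (s N) / m N) atTop (𝓝 l)) :
    Tendsto (fun N => (Measure.pi fun _ : Fin N => μ).real {z | m N ≤ sampleCount z (s N)})
      atTop (𝓝 0) := by
  obtain ⟨θ, h1, h2⟩ := exists_between hl
  have hθ : 0 < θ := hl0.trans_lt h1
  have hc : Real.log θ + 1 - θ < 0 := by
    have := Real.log_lt_sub_one_of_pos hθ h2.ne
    linarith
  have hexp : Tendsto (fun N => Real.exp (m N * (Real.log θ + 1 - θ))) atTop (𝓝 0) :=
    Real.tendsto_exp_atBot.comp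
      ((tendsto_natCast_atTop_atTop.comp hm).atTop_mul_const_of_neg hc)
  refine squeeze_zero' (Eventually.of_forall fun _ => measureReal_nonneg) ?_ hexp
  filter_upwards [h.eventually_lt_const h1, hm.eventually_ge_atTop 1] with N hN hm1
  refine measureReal_le_sampleCount_le μ (hs N) hθ h2.le ?_
  rw [div_lt_iff₀ (by exact_mod_cast hm1)] at hN
  exact hN.le

theorem tendsto_measureReal_sampleCount_lt (μ : Measure ℝ) [IsProbabilityMeasure μ]
    {s : ℕ → Set ℝ} (hs : ∀ N, MeasurableSet (s N)) {m : ℕ → ℕ} (hm : Tendsto m atTop atTop)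
    {l : ℝ} (hl : 1 < l) (h : Tendsto (fun N : ℕ => N * μ.real (s N) / m N) atTop (𝓝 l)) :
    Tendsto (fun N => (Measure.pi fun _ : Fin N => μ).real {z | sampleCount z (s N) < m N})
      atTop (𝓝 0) := by
  obtain ⟨θ, h1, h2⟩ := exists_between hl
  have hc : Real.log θ + 1 - θ < 0 := by
    have := Real.log_lt_sub_one_of_pos (by linarith : 0 < θ) h1.ne'
    linarith
  have hexp : Tendsto (fun N => Real.exp (m N * (Real.log θ + 1 - θ))) atTop (𝓝 0) :=
    Real.tendsto_exp_atBot.comp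
      ((tendsto_natCast_atTop_atTop.comp hm).atTop_mul_const_of_neg hc)
  refine squeeze_zero' (Eventually.of_forall fun _ => measureReal_nonneg) ?_ hexp
  filter_upwards [h.eventually_const_lt h2, hm.eventually_ge_atTop 1] with N hN hm1
  refine measureReal_sampleCount_lt_le μ (hs N) h1.le ?_
  rw [lt_div_iff₀ (by exact_mod_cast hm1)] at hN
  exact hN.le

/-- Both one-sided Lebesgue differentiation limits of `μ` at `x` are `v`. -/
def HasOneSidedDensities (μ : Measure ℝ) (v x : ℝ) : Prop :=
  Tendsto (fun ρ => μ.real (Set.Icc x (x + ρ)) / ρ) (𝓝[>] 0) (𝓝 v) ∧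
    Tendsto (fun ρ => μ.real (Set.Icc (x - ρ) x) / ρ) (𝓝[>] 0) (𝓝 v)

theorem ae_hasOneSidedDensities {f : ℝ → ℝ} (hf : Measurable f) (hf0 : ∀ x, 0 ≤ f x)
    (μ : Measure ℝ) [IsProbabilityMeasure μ]
    (hμ : μ = volume.withDensity fun x => ENNReal.ofReal (f x)) :
    ∀ᵐ x ∂volume, HasOneSidedDensities μ (f x) x := by
  have h1 := VitaliFamily.ae_tendsto_rnDeriv (IsUnifLocDoublingMeasure.vitaliFamily (volume : Measure ℝ) 1) μ
  have h2 : μ.rnDeriv volume =ᵐ[volume] fun x => ENNReal.ofReal (f x) := by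
    rw [hμ]; exact Measure.rnDeriv_withDensity volume hf.ennreal_ofReal
  filter_upwards [h1, h2] with x hx hx2
  rw [hx2] at hx
  have hx3 := (ENNReal.tendsto_toReal ENNReal.ofReal_ne_top).comp hx
  rw [ENNReal.toReal_ofReal (hf0 x)] at hx3
  constructor
  · have h3 : Tendsto (fun ρ : ℝ => x + ρ) (𝓝[>] 0) (𝓝[>] x) := by
      refine tendsto_nhdsWithin_iff.2 ⟨?_, ?_⟩
      · have : Tendsto (fun ρ : ℝ => x + ρ) (𝓝 0) (𝓝 (x + 0)) :=
          (continuous_const.add continuous_id).tendsto 0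
        rw [add_zero] at this
        exact this.mono_left nhdsWithin_le_nhds
      · filter_upwards [self_mem_nhdsWithin] with ρ hρ
        simpa using hρ
    refine (hx3.comp ((Real.tendsto_Icc_vitaliFamily_right x).comp h3)).congr' ?_
    filter_upwards [self_mem_nhdsWithin] with ρ hρ
    have hρ' : (0 : ℝ) ≤ ρ := le_of_lt hρ
    simp [Function.comp, ENNReal.toReal_div, Measure.real, Real.volume_Icc, hρ']
  · have h3 : Tendsto (fun ρ : ℝ => x - ρ) (𝓝[>] 0) (𝓝[<] x) := by
      refine tendsto_nhdsWithin_iff.2 ⟨?_, ?_⟩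
      · have : Tendsto (fun ρ : ℝ => x - ρ) (𝓝 0) (𝓝 (x - 0)) :=
          (continuous_const.sub continuous_id).tendsto 0
        rw [sub_zero] at this
        exact this.mono_left nhdsWithin_le_nhds
      · filter_upwards [self_mem_nhdsWithin] with ρ hρ
        simpa using hρ
    refine (hx3.comp ((Real.tendsto_Icc_vitaliFamily_left x).comp h3)).congr' ?_
    filter_upwards [self_mem_nhdsWithin] with ρ hρ
    have hρ' : (0 : ℝ) ≤ ρ := le_of_lt hρ
    simp [Function.comp, ENNReal.toReal_div, Measure.real, Real.volume_Icc, hρ']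

/-- The half-width of a window in which a sample of size `N + 1` from a density with value `v`
is expected to have `m` observations on either side. -/
noncomputable def halfWidth (N m : ℕ) (v : ℝ) : ℝ := m / ((N + 1 : ℕ) * v)

theorem tendsto_mul_measureReal_div {p : ℝ → ℝ} {v : ℝ} (hv : 0 < v)
    (hp : Tendsto (fun ρ => p ρ / ρ) (𝓝[>] 0) (𝓝 v)) {m : ℕ → ℕ} (hm : Tendsto m atTop atTop)
    (hmn : Tendsto (fun N : ℕ => (m N : ℝ) / (N + 1 : ℕ)) atTop (𝓝 0)) {c : ℝ} (hc : 0 < c) :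
    Tendsto (fun N : ℕ => N * p (halfWidth N (m N) (c * v)) / m N) atTop (𝓝 c⁻¹) := by
  have hcv : 0 < c * v := by positivity
  have h0 : Tendsto (fun N : ℕ => halfWidth N (m N) (c * v)) atTop (𝓝[>] 0) := by
    refine tendsto_nhdsWithin_iff.2 ⟨?_, ?_⟩
    · have := hmn.div_const (c * v)
      rw [zero_div] at this
      refine this.congr fun N => ?_
      rw [halfWidth, div_div]
    · filter_upwards [hm.eventually_ge_atTop 1] with N hN
      have : (0 : ℝ) < m N := by exact_mod_cast hN
      have h2 : (0 : ℝ) < (N + 1 : ℕ) := by positivity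
      simp only [Set.mem_Ioi, halfWidth]
      positivity
  have h1 : Tendsto (fun N : ℕ => (N : ℝ) / (N + 1 : ℕ)) atTop (𝓝 1) := by
    simpa using tendsto_natCast_div_add_atTop (1 : ℝ)
  have h2 := ((hp.comp h0).mul h1).div_const (c * v)
  rw [mul_one, div_mul_cancel_right₀ hv.ne'] at h2
  refine h2.congr' ?_
  filter_upwards [hm.eventually_ge_atTop 1] with N hN
  have : (0 : ℝ) < m N := by exact_mod_cast hN
  have h2 : (0 : ℝ) < (N + 1 : ℕ) := by positivity
  simp only [Function.comp, halfWidth]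
  field_simp

/-- At a point with positive one-sided densities, the trap closes with high probability. -/
theorem tendsto_measure_not_spacingTrap (μ : Measure ℝ) [IsProbabilityMeasure μ] [NullSingletonClass μ]
    {v x : ℝ} (hv : 0 < v) (hx : HasOneSidedDensities μ v x) {m : ℕ → ℕ}
    (hm : Tendsto m atTop atTop)
    (hmn : Tendsto (fun N : ℕ => (m N : ℝ) / (N + 1 : ℕ)) atTop (𝓝 0))
    {δ : ℝ} (hδ : 0 < δ) (hδ1 : δ < 1) :
    Tendsto (fun N => (Measure.pi fun _ : Fin N => μ) {z | ¬ spacingTrap (m N) x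
      (halfWidth N (m N) ((1 + δ) * v)) (halfWidth N (m N) ((1 - δ) * v)) z}) atTop (𝓝 0) := by
  have hinv1 : (1 + δ)⁻¹ < 1 := inv_lt_one_of_one_lt₀ (by linarith)
  have hinv2 : 1 < (1 - δ)⁻¹ := (one_lt_inv₀ (by linarith)).2 (by linarith)
  have a1 := tendsto_measureReal_sampleCount_lt μ
    (s := fun N => Set.Ioc x (x + halfWidth N (m N) ((1 - δ) * v)))
    (fun N => measurableSet_Ioc) hm hinv2 (by
      simp_rw [measureReal_congr (μ := μ) Ioc_ae_eq_Icc]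
      exact tendsto_mul_measureReal_div hv hx.1 hm hmn (by linarith))
  have a2 := tendsto_measureReal_sampleCount_lt μ
    (s := fun N => Set.Ico (x - halfWidth N (m N) ((1 - δ) * v)) x)
    (fun N => measurableSet_Ico) hm hinv2 (by
      simp_rw [measureReal_congr (μ := μ) Ico_ae_eq_Icc]
      exact tendsto_mul_measureReal_div hv hx.2 hm hmn (by linarith))
  have a3 := tendsto_measureReal_le_sampleCount μ
    (s := fun N => Set.Icc x (x + halfWidth N (m N) ((1 + δ) * v)))
    (fun N => measurableSet_Icc) hm (by positivity) hinv1
    (tendsto_mul_measureReal_div hv hx.1 hm hmn (by linarith))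
  have a4 := tendsto_measureReal_le_sampleCount μ
    (s := fun N => Set.Icc (x - halfWidth N (m N) ((1 + δ) * v)) x)
    (fun N => measurableSet_Icc) hm (by positivity) hinv1
    (tendsto_mul_measureReal_div hv hx.2 hm hmn (by linarith))
  have hsum := ENNReal.tendsto_ofReal ((a1.add a2).add (a3.add a4))
  simp only [add_zero, ENNReal.ofReal_zero] at hsum
  refine tendsto_of_tendsto_of_tendsto_of_le_of_le tendsto_const_nhds hsum (fun _ => zero_le) ?_
  intro N
  dsimp only
  rw [← ofReal_measureReal]
  refine ENNReal.ofReal_le_ofReal ?_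
  refine le_trans ?_ (add_le_add (measureReal_union_le _ _) (measureReal_union_le _ _))
  refine le_trans ?_ (measureReal_union_le _ _)
  refine measureReal_mono fun z hz => ?_
  simp only [spacingTrap, Set.mem_ofPred_eq, Set.mem_union] at hz ⊢
  grind

theorem measurableSet_spacingTrap {N : ℕ} (m : ℕ) {ρ₁ ρ₂ : ℝ → ℝ} (h₁ : Measurable ρ₁)
    (h₂ : Measurable ρ₂) :
    MeasurableSet {q : ℝ × (Fin N → ℝ) | ¬ spacingTrap m q.1 (ρ₁ q.1) (ρ₂ q.1) q.2} := by
  have e1 : MeasurableSet {q : ℝ × ℝ | q.2 ∈ Set.Ioc q.1 (q.1 + ρ₂ q.1)} := by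
    simp only [Set.mem_Ioc, Set.ofPred_and]
    exact (measurableSet_lt (by fun_prop) (by fun_prop)).inter
      (measurableSet_le (by fun_prop) (by fun_prop))
  have e2 : MeasurableSet {q : ℝ × ℝ | q.2 ∈ Set.Ico (q.1 - ρ₂ q.1) q.1} := by
    simp only [Set.mem_Ico, Set.ofPred_and]
    exact (measurableSet_le (by fun_prop) (by fun_prop)).inter
      (measurableSet_lt (by fun_prop) (by fun_prop))
  have e3 : MeasurableSet {q : ℝ × ℝ | q.2 ∈ Set.Icc q.1 (q.1 + ρ₁ q.1)} := by
    simp only [Set.mem_Icc, Set.ofPred_and]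
    exact (measurableSet_le (by fun_prop) (by fun_prop)).inter
      (measurableSet_le (by fun_prop) (by fun_prop))
  have e4 : MeasurableSet {q : ℝ × ℝ | q.2 ∈ Set.Icc (q.1 - ρ₁ q.1) q.1} := by
    simp only [Set.mem_Icc, Set.ofPred_and]
    exact (measurableSet_le (by fun_prop) (by fun_prop)).inter
      (measurableSet_le (by fun_prop) (by fun_prop))
  have hc : ∀ p : ℝ × (Fin N → ℝ) → Prop, {q | ¬ p q} = {q | p q}ᶜ := fun _ => rfl
  rw [hc]
  refine MeasurableSet.compl ?_
  simp only [spacingTrap, Set.ofPred_and]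
  exact ((measurableSet_le measurable_const
    (measurable_sampleCount_prod (S := fun y => Set.Ioc y (y + ρ₂ y)) e1)).inter
    (measurableSet_le measurable_const
      (measurable_sampleCount_prod (S := fun y => Set.Ico (y - ρ₂ y) y) e2))).inter
    ((measurableSet_lt (measurable_sampleCount_prod (S := fun y => Set.Icc y (y + ρ₁ y)) e3)
      measurable_const).inter
    (measurableSet_lt (measurable_sampleCount_prod (S := fun y => Set.Icc (y - ρ₁ y) y) e4)
      measurable_const))

theorem measurableSet_le_sampleCount_Icc (N m : ℕ) (r : ℝ) :
    MeasurableSet {q : ℝ × (Fin N → ℝ) | m ≤ sampleCount q.2 (Set.Icc (q.1 - r) (q.1 + r))} := by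
  refine measurableSet_le measurable_const
    (measurable_sampleCount_prod (S := fun y => Set.Icc (y - r) (y + r)) ?_)
  simp only [Set.mem_Icc, Set.ofPred_and]
  exact (measurableSet_le (by fun_prop) (by fun_prop)).inter
    (measurableSet_le (by fun_prop) (by fun_prop))

open scoped ENNReal in
/-- An upper bound for the squared error of the spacing density at an observation `q.1`, in terms
of counts of the remaining observations `q.2`. -/
noncomputable def errorBound (f : ℝ → ℝ) (δ : ℝ) (J N m : ℕ) (q : ℝ × (Fin N → ℝ)) : ℝ≥0∞ :=
  ENNReal.ofReal (3 * δ) * ENNReal.ofReal (f q.1 ^ 2) +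
    {q : ℝ × (Fin N → ℝ) | ¬ spacingTrap m q.1 (halfWidth N m ((1 + δ) * f q.1))
        (halfWidth N m ((1 - δ) * f q.1)) q.2}.indicator
      (fun q => 4 ^ J + ENNReal.ofReal (f q.1 ^ 2)) q +
    ∑' j : ℕ, {q : ℝ × (Fin N → ℝ) | m ≤ sampleCount q.2
        (Set.Icc (q.1 - 2 * m / ((N + 1 : ℕ) * 2 ^ (j + J)))
          (q.1 + 2 * m / ((N + 1 : ℕ) * 2 ^ (j + J))))}.indicator
      (fun _ => 4 ^ (j + J + 1)) q

theorem measurable_halfWidth (N m : ℕ) {g : ℝ → ℝ} (hg : Measurable g) :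
    Measurable fun y => halfWidth N m (g y) := by
  unfold halfWidth
  fun_prop

theorem measurable_errorBound {f : ℝ → ℝ} (hf : Measurable f) (δ : ℝ) (J N m : ℕ) :
    Measurable (errorBound f δ J N m) := by
  have h1 : Measurable fun q : ℝ × (Fin N → ℝ) =>
      ENNReal.ofReal (3 * δ) * ENNReal.ofReal (f q.1 ^ 2) := by fun_prop
  unfold errorBound
  refine Measurable.add (Measurable.add h1 ?_) (Measurable.tsum fun j => ?_)
  · exact Measurable.indicator
      (f := fun q : ℝ × (Fin N → ℝ) => 4 ^ J + ENNReal.ofReal (f q.1 ^ 2)) (by fun_prop) (measurableSet_spacingTrap m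
      (measurable_halfWidth N m (hf.const_mul _)) (measurable_halfWidth N m (hf.const_mul _)))
  · exact measurable_const.indicator (measurableSet_le_sampleCount_Icc N m _)

open scoped ENNReal in
theorem ofReal_sq_le_tsum (T : ℝ) (J : ℕ) :
    ENNReal.ofReal (T ^ 2) ≤ 4 ^ J + ∑' j : ℕ, if 2 ^ (j + J) < |T| then (4 : ℝ≥0∞) ^ (j + J + 1) else 0 := by
  have h4 : ∀ i : ℕ, ENNReal.ofReal ((2 ^ i) ^ 2) = 4 ^ i := by
    intro i
    rw [← pow_mul, mul_comm, pow_mul, ENNReal.ofReal_pow (by norm_num)]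
    norm_num
  rw [← sq_abs]
  by_cases h : |T| ≤ 2 ^ J
  · refine le_trans ?_ le_self_add
    rw [← h4]
    exact ENNReal.ofReal_le_ofReal (pow_le_pow_left₀ (abs_nonneg _) h 2)
  · refine le_trans ?_ le_add_self
    push Not at h
    have h0 : (0 : ℝ) < 2 ^ J := by positivity
    obtain ⟨j, hj1, hj2⟩ := exists_nat_pow_near (y := (2 : ℝ)) ((one_lt_div h0).2 h).le
      (by norm_num)
    obtain ⟨i, hi1, hi2⟩ : ∃ i : ℕ, (2 : ℝ) ^ (i + J) < |T| ∧ |T| ≤ 2 ^ (i + J + 1) := by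
      rcases hj1.lt_or_eq with h1 | h1
      · refine ⟨j, ?_, ?_⟩
        · rwa [lt_div_iff₀ h0, ← pow_add] at h1
        · rw [div_lt_iff₀ h0, ← pow_add] at hj2
          exact hj2.le.trans (le_of_eq (by ring))
      · rw [eq_div_iff h0.ne', ← pow_add] at h1
        rcases j with _ | j
        · rw [zero_add] at h1
          exact absurd h1 h.ne
        · refine ⟨j, ?_, ?_⟩
          · rw [← h1]; exact pow_lt_pow_right₀ (by norm_num) (by omega)
          · rw [← h1]; exact le_of_eq (by ring)
    refine le_trans ?_ (ENNReal.le_tsum i)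
    rw [if_pos hi1, ← h4]
    exact ENNReal.ofReal_le_ofReal (pow_le_pow_left₀ (abs_nonneg _) hi2 2)

theorem ofReal_abs_sub_le_errorBound {f : ℝ → ℝ} (hf0 : ∀ x, 0 ≤ f x) {δ : ℝ} (hδ : 0 < δ)
    (hδ1 : δ < 1) (J : ℕ) {N m : ℕ} (hm : 0 < m) (hmN : 2 * m ≤ N) (x : Fin (N + 1) → ℝ)
    (k : Fin (N + 1)) :
    ENNReal.ofReal |spacingDensity m x (sampleRank x k) ^ 2 - f (x k) ^ 2| ≤
      errorBound f δ J N m (x k, k.removeNth x) := by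
  set T := spacingDensity m x (sampleRank x k) with hT
  have hT0 : 0 ≤ T := spacingDensity_nonneg m x _
  by_cases htrap : spacingTrap m (x k) (halfWidth N m ((1 + δ) * f (x k)))
      (halfWidth N m ((1 - δ) * f (x k))) (k.removeNth x)
  · unfold errorBound
    refine le_trans ?_ (le_self_add.trans le_self_add)
    have hmR : (0 : ℝ) < m := by exact_mod_cast hm
    have hnR : (0 : ℝ) < (N + 1 : ℕ) := by positivity
    have hfx : 0 < f (x k) := by
      refine (hf0 _).lt_of_ne fun h => ?_
      have := htrap.1.1
      rw [← h] at this
      simp [halfWidth, sampleCount] at this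
      omega
    have hρ : 0 < halfWidth N m ((1 + δ) * f (x k)) := by
      unfold halfWidth; positivity
    have h1 := spacingDensity_mem_of_spacingTrap hm x k hρ htrap
    have key : ∀ c : ℝ, c ≠ 0 → (m : ℝ) / ((N + 1 : ℕ) * halfWidth N m (c * f (x k))) =
        c * f (x k) := by
      intro c hc
      unfold halfWidth
      have := hfx.ne'
      field_simp
    rw [key _ (sub_pos.2 hδ1).ne', key _ (by positivity : 1 + δ ≠ 0)] at h1
    rw [← ENNReal.ofReal_mul (by positivity)]
    refine ENNReal.ofReal_le_ofReal (abs_le.2 ⟨?_, ?_⟩)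
    · nlinarith [pow_le_pow_left₀ (by nlinarith : 0 ≤ (1 - δ) * f (x k)) h1.1 2, sq_nonneg (f (x k)),
        mul_pos hδ (pow_pos hfx 2), mul_pos (mul_pos hδ hδ) (pow_pos hfx 2)]
    · have h2 := pow_le_pow_left₀ hT0 h1.2 2
      have h3 : ((1 + δ) * f (x k)) ^ 2 = f (x k) ^ 2 + 2 * δ * f (x k) ^ 2 + δ * (δ * f (x k) ^ 2) := by
        ring
      have h4 : δ * (δ * f (x k) ^ 2) ≤ 1 * (δ * f (x k) ^ 2) := by gcongr
      linarith
  · unfold errorBound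
    rw [add_assoc]
    refine le_trans ?_ le_add_self
    rw [Set.indicator_of_mem (by simpa using htrap)]
    have h1 : |T ^ 2 - f (x k) ^ 2| ≤ T ^ 2 + f (x k) ^ 2 := by
      rw [abs_le]; constructor <;> nlinarith [sq_nonneg T, sq_nonneg (f (x k))]
    refine (ENNReal.ofReal_le_ofReal h1).trans ?_
    rw [ENNReal.ofReal_add (by positivity) (by positivity), add_right_comm]
    gcongr
    refine (ofReal_sq_le_tsum T J).trans ?_
    gcongr with j
    split_ifs with h
    · rw [abs_of_nonneg hT0] at h
      rw [Set.indicator_of_mem]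
      have := le_sampleCount_of_lt_spacingDensity hmN x k (by positivity) h
      simpa using this
    · exact zero_le

open scoped ENNReal in
theorem tsum_tailBound_ne_top {f : ℝ → ℝ} (hf : Measurable f) (hf0 : ∀ x, 0 ≤ f x)
    (h3 : Integrable (fun x => f x ^ 3) volume) :
    ∑' j : ℕ, (4 : ℝ≥0∞) ^ (j + 1) * ∫⁻ x, ENNReal.ofReal (tailBound (2 ^ j) (f x)) ≠ ∞ := by
  have hmeas : ∀ j : ℕ, Measurable fun x => ENNReal.ofReal (tailBound (2 ^ j) (f x)) :=
    fun j => ((measurable_tailBound _).comp hf).ennreal_ofReal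
  have hfin : ∫⁻ x, ENNReal.ofReal ((400 + 8 * 24 ^ 4) * f x ^ 3) ≠ ∞ :=
    (h3.const_mul _).lintegral_lt_top.ne
  refine ne_top_of_le_ne_top hfin (ENNReal.tsum_le_of_sum_range_le fun J => ?_)
  rw [Finset.sum_congr rfl fun j _ => (lintegral_const_mul (4 ^ (j + 1)) (hmeas j)).symm]
  rw [← lintegral_finsetSum _ fun j _ => (hmeas j).const_mul _]
  refine lintegral_mono fun x => ?_
  have h4 : ∀ j : ℕ, (4 : ℝ≥0∞) ^ (j + 1) * ENNReal.ofReal (tailBound (2 ^ j) (f x)) =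
      ENNReal.ofReal (4 ^ (j + 1) * tailBound (2 ^ j) (f x)) := by
    intro j
    rw [ENNReal.ofReal_mul (by positivity), ENNReal.ofReal_pow (by norm_num)]
    norm_num
  simp_rw [h4]
  rw [← ENNReal.ofReal_sum_of_nonneg fun j _ =>
    mul_nonneg (by positivity) (tailBound_nonneg (by positivity) (hf0 x))]
  exact ENNReal.ofReal_le_ofReal (sum_tailBound_le (hf0 x) J)

theorem lintegral_measure_le_sampleCount_le {f : ℝ → ℝ} (hf : Measurable f) (hf0 : ∀ x, 0 ≤ f x)
    (μ : Measure ℝ) [IsProbabilityMeasure μ]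
    (hμ : μ = volume.withDensity fun x => ENNReal.ofReal (f x)) {N m : ℕ} (hm : 4 ≤ m) {t : ℝ}
    (ht : 0 < t) :
    ∫⁻ y, (Measure.pi fun _ : Fin N => μ) {z | m ≤ sampleCount z
        (Set.Icc (y - 2 * m / ((N + 1 : ℕ) * t)) (y + 2 * m / ((N + 1 : ℕ) * t)))} ∂μ ≤
      ∫⁻ x, ENNReal.ofReal (tailBound t (f x)) := by
  have hmR : (0 : ℝ) < m := by exact_mod_cast (by omega : 0 < m)
  have hnR : (0 : ℝ) < (N + 1 : ℕ) := by positivity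
  set r : ℝ := 2 * m / ((N + 1 : ℕ) * t) with hr
  have hr0 : 0 < r := by positivity
  set K : ℝ := 3 * (N + 1 : ℕ) / m with hK
  have hK0 : 0 ≤ K := by positivity
  refine le_trans ?_ (lintegral_mul_min_le hf hf0 hr0 ht hK0 (by rw [hr, hK]; field_simp; norm_num))
  have hpt : ∀ y, (Measure.pi fun _ : Fin N => μ) {z | m ≤ sampleCount z
        (Set.Icc (y - r) (y + r))} ≤ min 1 ((ENNReal.ofReal K *
        ∫⁻ y in Set.Icc (y - r) (y + r), ENNReal.ofReal (f y)) ^ 4) := by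
    intro y
    have h1 := measureReal_le_sampleCount_le_pow_four μ (N := N) hm
      (measurableSet_Icc (a := y - r) (b := y + r))
      (y := (N + 1 : ℕ) / m * μ.real (Set.Icc (y - r) (y + r))) (by positivity) (by
        rw [mul_right_comm, div_mul_cancel₀ _ hmR.ne']
        gcongr
        exact_mod_cast Nat.le_succ N)
    rw [← withDensity_apply _ measurableSet_Icc, ← hμ, ← ofReal_measureReal,
      ← ofReal_measureReal (μ := μ), ← ENNReal.ofReal_mul hK0, ← ENNReal.ofReal_pow (by positivity),
      ← ENNReal.ofReal_one, ← ENNReal.ofReal_min]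
    refine ENNReal.ofReal_le_ofReal (h1.trans (le_of_eq ?_))
    rw [hK]
    congr 2
    ring
  refine (lintegral_mono hpt).trans (le_of_eq ?_)
  rw [hμ, lintegral_withDensity_eq_lintegral_mul _ hf.ennreal_ofReal]
  · rfl
  · exact measurable_const.min
      ((measurable_const.mul (measurable_setLIntegral_Icc hf.ennreal_ofReal r)).pow_const 4)

open scoped ENNReal in
theorem lintegral_ofReal_sq {f : ℝ → ℝ} (hf : Measurable f) (hf0 : ∀ x, 0 ≤ f x)
    (μ : Measure ℝ) (hμ : μ = volume.withDensity fun x => ENNReal.ofReal (f x)) :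
    ∫⁻ y, ENNReal.ofReal (f y ^ 2) ∂μ = ∫⁻ y, ENNReal.ofReal (f y ^ 3) := by
  rw [hμ, lintegral_withDensity_eq_lintegral_mul _ hf.ennreal_ofReal (by fun_prop)]
  refine lintegral_congr fun y => ?_
  simp only [Pi.mul_apply]
  rw [← ENNReal.ofReal_mul (hf0 y)]
  congr 1; ring

open scoped ENNReal in
theorem lintegral_errorBound_le {f : ℝ → ℝ} (hf : Measurable f) (hf0 : ∀ x, 0 ≤ f x)
    (μ : Measure ℝ) [IsProbabilityMeasure μ]
    (hμ : μ = volume.withDensity fun x => ENNReal.ofReal (f x)) (δ : ℝ) (J : ℕ) {N m : ℕ}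
    (hm : 4 ≤ m) :
    ∫⁻ q, errorBound f δ J N m q ∂(μ.prod (Measure.pi fun _ => μ)) ≤
      (ENNReal.ofReal (3 * δ) * ∫⁻ y, ENNReal.ofReal (f y ^ 3)) +
      (∫⁻ y, (4 ^ J + ENNReal.ofReal (f y ^ 2)) * (Measure.pi fun _ : Fin N => μ)
        {z | ¬ spacingTrap m y (halfWidth N m ((1 + δ) * f y)) (halfWidth N m ((1 - δ) * f y)) z} ∂μ)
      + ∑' j : ℕ, (4 : ℝ≥0∞) ^ (j + J + 1) *
        ∫⁻ x, ENNReal.ofReal (tailBound (2 ^ (j + J)) (f x)) := by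
  have hprod : ∀ (S : Set (ℝ × (Fin N → ℝ))) (g : ℝ → ℝ≥0∞), MeasurableSet S → Measurable g →
      ∫⁻ q, S.indicator (fun q => g q.1) q ∂(μ.prod (Measure.pi fun _ : Fin N => μ)) =
        ∫⁻ y, g y * (Measure.pi fun _ : Fin N => μ) {z | (y, z) ∈ S} ∂μ := by
    intro S g hS hg
    have hg1 : Measurable fun q : ℝ × (Fin N → ℝ) => g q.1 := hg.comp measurable_fst
    rw [lintegral_prod _ (hg1.indicator hS).aemeasurable]
    refine lintegral_congr fun y => ?_
    have hSy : MeasurableSet {z | (y, z) ∈ S} := measurable_prodMk_left hS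
    exact lintegral_indicator_const hSy (g y)
  have hS := measurableSet_spacingTrap (N := N) m
      (measurable_halfWidth N m (hf.const_mul (1 + δ)))
      (measurable_halfWidth N m (hf.const_mul (1 - δ)))
  have hg : Measurable fun y => (4 : ℝ≥0∞) ^ J + ENNReal.ofReal (f y ^ 2) := by fun_prop
  have hm1 : Measurable fun q : ℝ × (Fin N → ℝ) =>
      ENNReal.ofReal (3 * δ) * ENNReal.ofReal (f q.1 ^ 2) := by fun_prop
  have hg1 : Measurable fun q : ℝ × (Fin N → ℝ) =>
      (4 : ℝ≥0∞) ^ J + ENNReal.ofReal (f q.1 ^ 2) := by fun_prop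
  have hm2 := hg1.indicator hS
  unfold errorBound
  refine (lintegral_add_left (hm1.add hm2) _).trans_le (add_le_add
    ((lintegral_add_left hm1 _).trans_le (add_le_add ?_ ?_)) ((lintegral_tsum fun j =>
    (measurable_const.indicator (measurableSet_le_sampleCount_Icc N m _)).aemeasurable).trans_le
    (ENNReal.tsum_le_tsum fun j => ?_)))
  · rw [lintegral_prod _ hm1.aemeasurable]
    simp only [lintegral_const, measure_univ, mul_one]
    rw [lintegral_const_mul _ (by fun_prop), lintegral_ofReal_sq hf hf0 μ hμ]
  · exact (hprod _ _ hS hg).le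
  · rw [hprod _ (fun _ => (4 : ℝ≥0∞) ^ (j + J + 1)) (measurableSet_le_sampleCount_Icc N m _)
      measurable_const, lintegral_const_mul' _ _ (by finiteness)]
    exact mul_le_mul' le_rfl (lintegral_measure_le_sampleCount_le hf hf0 μ hμ hm (by positivity))

open scoped ENNReal in
/-- The squared error of the spacing density has an eventually small dominating function. -/
theorem eventually_lintegral_errorBound_le {f : ℝ → ℝ} (hf : Measurable f) (hf0 : ∀ x, 0 ≤ f x)
    (μ : Measure ℝ) [IsProbabilityMeasure μ]
    (hμ : μ = volume.withDensity fun x => ENNReal.ofReal (f x))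
    (h3 : Integrable (fun x => f x ^ 3) volume) {m : ℕ → ℕ} (hm : Tendsto m atTop atTop)
    (hmn : Tendsto (fun N : ℕ => (m N : ℝ) / (N + 1 : ℕ)) atTop (𝓝 0)) {ε : ℝ≥0∞} (hε : ε ≠ 0) :
    ∃ (δ : ℝ) (J : ℕ), 0 < δ ∧ δ < 1 ∧ ∀ᶠ N in atTop,
      ∫⁻ q, errorBound f δ J N (m N) q ∂(μ.prod (Measure.pi fun _ => μ)) ≤ ε := by
  have hε3 : 0 < ε / 3 := ENNReal.div_pos hε (by norm_num)
  have hI : ∫⁻ y, ENNReal.ofReal (f y ^ 3) ≠ ∞ := h3.lintegral_lt_top.ne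
  have hna : NullSingletonClass μ := by rw [hμ]; infer_instance
  obtain ⟨δ, hδ, hδ0, hδ1⟩ : ∃ δ : ℝ,
      ENNReal.ofReal (3 * δ) * ∫⁻ y, ENNReal.ofReal (f y ^ 3) < ε / 3 ∧ 0 < δ ∧ δ < 1 := by
    have h1 : Tendsto (fun δ : ℝ => ENNReal.ofReal (3 * δ) * ∫⁻ y, ENNReal.ofReal (f y ^ 3))
        (𝓝[>] 0) (𝓝 (ENNReal.ofReal (3 * 0) * ∫⁻ y, ENNReal.ofReal (f y ^ 3))) := by
      refine ENNReal.Tendsto.mul_const (ENNReal.tendsto_ofReal ?_) (Or.inr hI)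
      exact ((continuous_const.mul continuous_id).tendsto (0 : ℝ)).mono_left nhdsWithin_le_nhds
    rw [mul_zero, ENNReal.ofReal_zero, zero_mul] at h1
    have h2 : ∀ᶠ δ : ℝ in 𝓝[>] 0, δ < 1 :=
      (eventually_lt_nhds one_pos).filter_mono nhdsWithin_le_nhds
    have h4 : ∀ᶠ δ : ℝ in 𝓝[>] 0, 0 < δ := self_mem_nhdsWithin
    exact ((h1.eventually_lt_const hε3).and (h4.and h2)).exists
  obtain ⟨J, hJ⟩ := ((ENNReal.tendsto_sum_nat_add _
    (tsum_tailBound_ne_top hf hf0 h3)).eventually_lt_const hε3).exists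
  refine ⟨δ, J, hδ0, hδ1, ?_⟩
  have hgood : ∀ᵐ y ∂μ, 0 < f y ∧ HasOneSidedDensities μ (f y) y := by
    have h1 := ae_hasOneSidedDensities hf hf0 μ hμ
    rw [hμ, ae_withDensity_iff hf.ennreal_ofReal, ← hμ]
    filter_upwards [h1] with y hy hy0
    exact ⟨by simpa using hy0, hy⟩
  have hdct : Tendsto (fun N => ∫⁻ y, (4 ^ J + ENNReal.ofReal (f y ^ 2)) *
      (Measure.pi fun _ : Fin N => μ) {z | ¬ spacingTrap (m N) y
        (halfWidth N (m N) ((1 + δ) * f y)) (halfWidth N (m N) ((1 - δ) * f y)) z} ∂μ)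
      atTop (𝓝 (∫⁻ _, 0 ∂μ)) := by
    refine tendsto_lintegral_of_dominated_convergence
      (fun y => 4 ^ J + ENNReal.ofReal (f y ^ 2)) ?_ ?_ ?_ ?_
    · intro N
      refine Measurable.mul (by fun_prop) ?_
      exact measurable_measure_prodMk_left (measurableSet_spacingTrap (N := N) (m N)
        (measurable_halfWidth N (m N) (hf.const_mul (1 + δ)))
        (measurable_halfWidth N (m N) (hf.const_mul (1 - δ))))
    · intro N
      exact Eventually.of_forall fun y => mul_le_of_le_one_right zero_le prob_le_one
    · rw [lintegral_add_left measurable_const, lintegral_const, measure_univ, mul_one,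
        lintegral_ofReal_sq hf hf0 μ hμ]
      finiteness
    · filter_upwards [hgood] with y hy
      have h1 := ENNReal.Tendsto.const_mul
        (tendsto_measure_not_spacingTrap μ hy.1 hy.2 hm hmn hδ0 hδ1)
        (a := 4 ^ J + ENNReal.ofReal (f y ^ 2)) (Or.inr (by finiteness))
      rwa [mul_zero] at h1
  rw [lintegral_zero] at hdct
  filter_upwards [hdct.eventually_lt_const hε3, hm.eventually_ge_atTop 4] with N hN hm4
  refine (lintegral_errorBound_le hf hf0 μ hμ δ J hm4).trans ?_
  calc _ ≤ ε / 3 + ε / 3 + ε / 3 := add_le_add (add_le_add hδ.le hN.le) hJ.le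
    _ = ε := ENNReal.add_thirds ε

theorem map_prodMk_removeNth {Ω : Type*} [MeasurableSpace Ω] {P : Measure Ω}
    [IsProbabilityMeasure P] {X : ℕ → Ω → ℝ} (hX : ∀ k, Measurable (X k)) (hindep : iIndepFun X P)
    {μ : Measure ℝ} [IsProbabilityMeasure μ] (hμ : ∀ k, P.map (X k) = μ) {N : ℕ} (k : Fin (N + 1)) :
    P.map (fun ω => (X k ω, k.removeNth fun j : Fin (N + 1) => X j ω)) =
      μ.prod (Measure.pi fun _ => μ) := by
  have h1 := (iIndepFun_iff_map_fun_eq_pi_map (fun j : Fin (N + 1) => (hX j).aemeasurable)).1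
    (hindep.precomp Fin.val_injective)
  simp only [hμ] at h1
  have h2 := (measurePreserving_piFinSuccAbove (fun _ : Fin (N + 1) => μ) k).map_eq
  rw [← h2, ← h1, Measure.map_map (by fun_prop) (by fun_prop)]
  rfl

/-- The mean error of the squared spacing densities, as estimates of `f ^ 2` at the
observations. -/
noncomputable def squareError (f : ℝ → ℝ) {n : ℕ} (m : ℕ) (x : Fin n → ℝ) : ℝ :=
  1 / (n : ℝ) * ∑ k, |spacingDensity m x (sampleRank x k) ^ 2 - f (x k) ^ 2|

theorem tendsto_measure_le_squareError {Ω : Type*} [MeasurableSpace Ω] {P : Measure Ω}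
    [IsProbabilityMeasure P] {X : ℕ → Ω → ℝ} (hX : ∀ k, Measurable (X k)) (hindep : iIndepFun X P)
    {f : ℝ → ℝ} (hf : Measurable f) (hf0 : ∀ x, 0 ≤ f x)
    (hlaw : ∀ k, P.map (X k) = volume.withDensity fun x => ENNReal.ofReal (f x))
    (h3 : Integrable (fun x => f x ^ 3) volume) {m : ℕ → ℕ} (hm : Tendsto m atTop atTop)
    (hmn : Tendsto (fun n : ℕ => (m n : ℝ) / (n : ℝ)) atTop (𝓝 0)) {η : ℝ} (hη : 0 < η) :
    Tendsto (fun n : ℕ => P {ω | η ≤ squareError f (m n) fun k : Fin n => X k ω})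
      atTop (𝓝 0) := by
  set μ : Measure ℝ := volume.withDensity fun x => ENNReal.ofReal (f x) with hμ
  have : IsProbabilityMeasure μ := by
    rw [← hlaw 0]; exact Measure.isProbabilityMeasure_map (hX 0).aemeasurable
  rw [← tendsto_add_atTop_iff_nat 1]
  have hm' := (tendsto_add_atTop_iff_nat 1).2 hm
  have hmn' := (tendsto_add_atTop_iff_nat 1).2 hmn
  have hη' : ENNReal.ofReal η ≠ 0 := by simpa using hη
  refine ENNReal.tendsto_nhds_zero.2 fun ε hε => ?_
  obtain ⟨δ, J, hδ0, hδ1, hev⟩ := eventually_lintegral_errorBound_le hf hf0 μ hμ h3 hm' hmn'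
    (mul_ne_zero hε.ne' hη')
  filter_upwards [hev, hm'.eventually_ge_atTop 1,
    hmn'.eventually_lt_const (by norm_num : (0 : ℝ) < 1 / 4)] with N hN hm1 hmN
  have hn : (0 : ℝ) < (N + 1 : ℕ) := by positivity
  have hmN' : 2 * m (N + 1) ≤ N := by
    rw [div_lt_iff₀ hn] at hmN
    have h4 : (4 * m (N + 1) : ℝ) < (N + 1 : ℕ) := by linarith
    have h5 : 4 * m (N + 1) < N + 1 := by exact_mod_cast h4
    omega
  have hmap : ∀ k : Fin (N + 1), Measurable fun ω =>
      (X k ω, k.removeNth fun j : Fin (N + 1) => X j ω) := by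
    intro k
    exact (hX k).prodMk (measurable_pi_lambda _ fun j => hX _)
  have hmeas : ∀ k : Fin (N + 1), Measurable fun ω => errorBound f δ J N (m (N + 1))
      (X k ω, k.removeNth fun j : Fin (N + 1) => X j ω) := fun k =>
    (measurable_errorBound hf δ J N _).comp (hmap k)
  have hle : ∀ ω, ENNReal.ofReal (squareError f (m (N + 1)) fun k : Fin (N + 1) => X k ω) ≤
      ENNReal.ofReal (1 / (N + 1 : ℕ)) * ∑ k : Fin (N + 1), errorBound f δ J N (m (N + 1))
        (X k ω, k.removeNth fun j : Fin (N + 1) => X j ω) := by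
    intro ω
    rw [squareError, ENNReal.ofReal_mul (by positivity),
      ENNReal.ofReal_sum_of_nonneg fun _ _ => abs_nonneg _]
    gcongr with k
    exact ofReal_abs_sub_le_errorBound hf0 hδ0 hδ1 J hm1 hmN' (fun k : Fin (N + 1) => X k ω) k
  calc P {ω | η ≤ squareError f (m (N + 1)) fun k : Fin (N + 1) => X k ω}
      ≤ P {ω | ENNReal.ofReal η ≤ ENNReal.ofReal (1 / (N + 1 : ℕ)) *
          ∑ k : Fin (N + 1), errorBound f δ J N (m (N + 1))
            (X k ω, k.removeNth fun j : Fin (N + 1) => X j ω)} :=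
        measure_mono fun ω hω => (ENNReal.ofReal_le_ofReal hω).trans (hle ω)
    _ ≤ _ := meas_ge_le_lintegral_div
        ((Finset.measurable_fun_sum _ fun k _ => hmeas k).const_mul _).aemeasurable hη'
          ENNReal.ofReal_ne_top
    _ ≤ ε := by
        refine ENNReal.div_le_of_le_mul ?_
        rw [lintegral_const_mul _ (Finset.measurable_fun_sum _ fun k _ => hmeas k),
          lintegral_finsetSum _ fun k _ => hmeas k]
        have hk : ∀ k : Fin (N + 1), ∫⁻ ω, errorBound f δ J N (m (N + 1))
            (X k ω, k.removeNth fun j : Fin (N + 1) => X j ω) ∂P ≤ ε * ENNReal.ofReal η := by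
          intro k
          rw [← lintegral_map (measurable_errorBound hf δ J N _) (hmap k),
            map_prodMk_removeNth hX hindep hlaw k]
          exact hN
        calc _ ≤ ENNReal.ofReal (1 / (N + 1 : ℕ)) *
              ∑ k : Fin (N + 1), ε * ENNReal.ofReal η := by
              gcongr with k; exact hk k
          _ = ε * ENNReal.ofReal η := by
              rw [Finset.sum_const, Finset.card_univ, Fintype.card_fin, nsmul_eq_mul, ← mul_assoc,
                ← ENNReal.ofReal_natCast, ← ENNReal.ofReal_mul (by positivity),
                one_div_mul_cancel hn.ne', ENNReal.ofReal_one, one_mul]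

theorem abs_mean_sq_sub_le_squareError (f : ℝ → ℝ) {n : ℕ} (m : ℕ) (x : Fin n → ℝ) :
    |1 / (n : ℝ) * ∑ i, spacingDensity m x i ^ 2 - 1 / (n : ℝ) * ∑ k, f (x k) ^ 2| ≤
      squareError f m x := by
  rw [sum_spacingDensity_eq m x 2, ← mul_sub, ← Finset.sum_sub_distrib, abs_mul,
    abs_of_nonneg (by positivity : 0 ≤ 1 / (n : ℝ))]
  exact mul_le_mul_of_nonneg_left (Finset.abs_sum_le_sum_abs _ _) (by positivity)

theorem sq_mean_sub_le_squareError {f : ℝ → ℝ} (hf0 : ∀ x, 0 ≤ f x) {n : ℕ} (m : ℕ)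
    (x : Fin n → ℝ) :
    (1 / (n : ℝ) * ∑ i, spacingDensity m x i - 1 / (n : ℝ) * ∑ k, f (x k)) ^ 2 ≤
      squareError f m x := by
  rcases Nat.eq_zero_or_pos n with rfl | hn
  · simp [squareError]
  have hn' : (0 : ℝ) < n := by exact_mod_cast hn
  have h1 := sum_spacingDensity_eq m x 1
  simp only [pow_one] at h1
  rw [h1, ← mul_sub, ← Finset.sum_sub_distrib, squareError]
  set a := fun k => spacingDensity m x (sampleRank x k)
  have h2 := sq_sum_le_card_mul_sum_sq (s := Finset.univ) (f := fun k => a k - f (x k))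
  rw [Finset.card_univ, Fintype.card_fin] at h2
  have h3 : ∑ k, (a k - f (x k)) ^ 2 ≤ ∑ k, |a k ^ 2 - f (x k) ^ 2| := by
    refine Finset.sum_le_sum fun k _ => ?_
    have ha : 0 ≤ a k := spacingDensity_nonneg m x _
    have hb := hf0 (x k)
    rw [show a k ^ 2 - f (x k) ^ 2 = (a k - f (x k)) * (a k + f (x k)) by ring, abs_mul, ← sq_abs,
      sq, abs_of_nonneg (add_nonneg ha hb)]
    refine mul_le_mul_of_nonneg_left ?_ (abs_nonneg _)
    rw [abs_le]; constructor <;> linarith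
  calc (1 / (n : ℝ) * ∑ k, (a k - f (x k))) ^ 2
      = (1 / (n : ℝ)) ^ 2 * (∑ k, (a k - f (x k))) ^ 2 := by ring
    _ ≤ (1 / (n : ℝ)) ^ 2 * (n * ∑ k, |a k ^ 2 - f (x k) ^ 2|) := by
        gcongr; exact h2.trans (by gcongr)
    _ = 1 / (n : ℝ) * ∑ k, |a k ^ 2 - f (x k) ^ 2| := by field_simp

theorem tendstoInMeasure_mean {Ω : Type*} [MeasurableSpace Ω] {P : Measure Ω}
    [IsProbabilityMeasure P] {X : ℕ → Ω → ℝ} (hX : ∀ k, Measurable (X k)) (hindep : iIndepFun X P)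
    (hid : ∀ k, P.map (X k) = P.map (X 0)) {g : ℝ → ℝ} (hg : Measurable g)
    (hint : Integrable (fun ω => g (X 0 ω)) P) :
    TendstoInMeasure P (fun (n : ℕ) ω => 1 / (n : ℝ) * ∑ k : Fin n, g (X k ω)) atTop
      (fun _ => ∫ ω, g (X 0 ω) ∂P) := by
  refine tendstoInMeasure_of_tendsto_ae (fun n => ?_) ?_
  · exact ((Finset.measurable_fun_sum _ fun (k : Fin n) _ =>
      hg.comp (hX k)).const_mul _).aestronglyMeasurable
  · have := strong_law_ae_real (μ := P) (fun k ω => g (X k ω)) hint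
      (fun i j hij => (hindep.indepFun hij).comp hg hg)
      (fun i => IdentDistrib.comp ⟨(hX i).aemeasurable, (hX 0).aemeasurable, hid i⟩ hg)
    filter_upwards [this] with ω hω
    refine hω.congr fun n => ?_
    rw [Finset.sum_range fun k => g (X k ω), div_eq_mul_one_div, mul_comm]

theorem mainTheorem2 {Ω : Type*} [MeasurableSpace Ω] (P : Measure Ω) [IsProbabilityMeasure P]
    (X : ℕ → Ω → ℝ) (hX : ∀ k, Measurable (X k)) (hindep : iIndepFun X P)
    (f : ℝ → ℝ) (hf : Measurable f) (hf_nonneg : ∀ x, 0 ≤ f x)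
    (hlaw : ∀ k, P.map (X k) = volume.withDensity (fun x => ENNReal.ofReal (f x)))
    (hVJ : Integrable (fun x => f x ^ 3) volume)
    (m : ℕ → ℕ) (hm : Tendsto m atTop atTop)
    (hmn : Tendsto (fun n : ℕ => (m n : ℝ) / (n : ℝ)) atTop (𝓝 0)) :
    TendstoInMeasure P
      (fun (n : ℕ) (ω : Ω) => varextropyEstimator (m n) (fun k : Fin n => X k ω))
      atTop (fun _ => varextropy P f (X 0)) := by
  have hmeas : Measurable fun ω => f (X 0 ω) := hf.comp (hX 0)
  have hsq : Integrable (fun ω => f (X 0 ω) ^ 2) P := by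
    refine ⟨(hmeas.pow_const 2).aestronglyMeasurable, ?_⟩
    rw [hasFiniteIntegral_iff_ofReal (Eventually.of_forall fun ω => sq_nonneg _),
      ← lintegral_map (f := fun y => ENNReal.ofReal (f y ^ 2)) (by fun_prop) (hX 0),
      lintegral_ofReal_sq hf hf_nonneg _ (hlaw 0)]
    exact hVJ.lintegral_lt_top
  have hL2 : MemLp (fun ω => f (X 0 ω)) 2 P :=
    (memLp_two_iff_integrable_sq hmeas.aestronglyMeasurable).2 hsq
  have hid : ∀ k, P.map (X k) = P.map (X 0) := fun k => by rw [hlaw k, hlaw 0]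
  have hA := tendstoInMeasure_mean hX hindep hid (hf.pow_const 2) hsq
  have hB := tendstoInMeasure_mean hX hindep hid hf (hL2.integrable one_le_two)
  set α := ∫ ω, f (X 0 ω) ^ 2 ∂P with hα
  set β := ∫ ω, f (X 0 ω) ∂P with hβ
  have hV : varextropy P f (X 0) = 1 / 4 * α - 1 / 4 * β ^ 2 := by
    unfold varextropy
    rw [variance_const_mul, variance_eq_sub hL2]
    simp only [Pi.pow_apply, ← hα, ← hβ]
    ring
  rw [tendstoInMeasure_iff_dist] at hA hB ⊢
  intro ε hε
  have hcont : Continuous fun q : ℝ × ℝ => 1 / 4 * q.1 - 1 / 4 * q.2 ^ 2 := by fun_prop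
  obtain ⟨η, hη, hball⟩ := Metric.continuousAt_iff.1 (hcont.continuousAt (x := (α, β))) ε hε
  have hη2 : 0 < η / 2 := by positivity
  have hD := tendsto_measure_le_squareError hX hindep hf hf_nonneg hlaw hVJ hm hmn
    (lt_min hη2 (pow_pos hη2 2))
  have hsum := (hD.add (hA (η / 2) hη2)).add (hB (η / 2) hη2)
  simp only [add_zero] at hsum
  refine tendsto_of_tendsto_of_tendsto_of_le_of_le tendsto_const_nhds hsum (fun _ => zero_le) ?_
  intro n
  refine le_trans ?_ (add_le_add (measure_union_le _ _) le_rfl)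
  refine le_trans ?_ (measure_union_le _ _)
  refine measure_mono fun ω hω => ?_
  simp only [Set.mem_ofPred_eq, Set.mem_union] at hω ⊢
  by_contra! hcon
  obtain ⟨⟨h1, h2⟩, h3⟩ := hcon
  refine hω.not_gt ?_
  have e1 := abs_mean_sq_sub_le_squareError f (m n) fun k : Fin n => X k ω
  have e2 := sq_mean_sub_le_squareError hf_nonneg (m n) fun k : Fin n => X k ω
  have h1a := e1.trans_lt (h1.trans_le (min_le_left _ _))
  have h1b := abs_lt_of_sq_lt_sq (e2.trans_lt (h1.trans_le (min_le_right _ _))) hη2.le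
  rw [Real.dist_eq] at h2 h3
  have hq := hball (x := (1 / (n : ℝ) * ∑ i, spacingDensity (m n) (fun k : Fin n => X k ω) i ^ 2,
    1 / (n : ℝ) * ∑ i, spacingDensity (m n) (fun k : Fin n => X k ω) i)) (by
      rw [Prod.dist_eq, Real.dist_eq, Real.dist_eq]
      refine max_lt ?_ ?_
      · refine (abs_sub_le _ (1 / (n : ℝ) * ∑ k : Fin n, f (X k ω) ^ 2) _).trans_lt ?_
        linarith
      · refine (abs_sub_le _ (1 / (n : ℝ) * ∑ k : Fin n, f (X k ω)) _).trans_lt ?_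
        linarith)
  have hest : varextropyEstimator (m n) (fun k : Fin n => X k ω) =
      1 / 4 * (1 / (n : ℝ) * ∑ i, spacingDensity (m n) (fun k : Fin n => X k ω) i ^ 2) -
        1 / 4 * (1 / (n : ℝ) * ∑ i, spacingDensity (m n) (fun k : Fin n => X k ω) i) ^ 2 := by
    rw [varextropyEstimator, ← mul_assoc, one_div_mul_one_div]
  rw [hest, hV]
  exact hq
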